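/- A \emph{sublebesgue measure} is a measure $\mu=f(x)\,dx$ on $[0,1]$ with measurable density $f:[0,1]\to[0,1]$. For a binary word $w=w_1\cdots w_k\in\{0,1\}^k$, the density of the pattern $w$ in $\mu$ is $$\rho_w(\mu)=k!\int_{0\le x_1<\dots<x_k\le 1}\ \prod_{i=1}^k g_i(x_i)\,dx_1\cdots dx_k,\qquad g_i=\begin{cases} f & \text{if } w_i=1,\\ 1-f & \text{if } w_i=0;\end{cases}$$ in particular $\rho_1(\mu)=\int_0^1 f(x)\,dx$. \textbf{Theorem.} Let $\tau$ be a finite binary word containing at least one $1$ and at least one $0$, and let $m$ and $n$ be the numbers of $1$s and $0$s in $\tau$. There is a constant $C_\tau\in\mathbb{R}$, depending only on $\tau$, such that for every $\rho\in[0,1]$ $$\{\rho_\tau(\mu) : \mu \text{ a sublebesgue measure with } \rho_1(\mu)=\rho\}=[0,\ C_\tau\,\rho^m(1-\rho)^n].$$ -/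

import Mathlib

open Set MeasureTheory

namespace PatternDensity

/-- `μ` is the sublebesgue measure `f(x) dx` on `[0,1]`: it is absolutely continuous with respect
to Lebesgue measure on `[0,1]`, with the measurable density `f` taking values in `[0,1]`. -/
structure IsSublebesgue (μ : Measure ℝ) (f : ℝ → ℝ) : Prop where
  measurable : Measurable f
  mem_Icc : ∀ x ∈ Icc (0 : ℝ) 1, f x ∈ Icc (0 : ℝ) 1
  eq_withDensity : μ = (volume.restrict (Icc (0 : ℝ) 1)).withDensity fun x => ENNReal.ofReal (f x)

/-- The ordered simplex `0 ≤ x₁ < ⋯ < x_k ≤ 1`. -/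
def orderedSimplex (k : ℕ) : Set (Fin k → ℝ) :=
  {x | (∀ i, x i ∈ Icc (0 : ℝ) 1) ∧ StrictMono x}

/-- The factor `f(x)` for the letter `1` (`true`), and `1 - f(x)` for the letter `0` (`false`). -/
def letterFactor (f : ℝ → ℝ) (b : Bool) (x : ℝ) : ℝ :=
  if b = true then f x else 1 - f x

/-- The density `ρ_w` of the binary word `w` (`true` is `1`, `false` is `0`) in the sublebesgue
measure `f(x) dx`. -/
noncomputable def patternDensity (w : List Bool) (f : ℝ → ℝ) : ℝ :=
  (w.length.factorial : ℝ) *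
    ∫ x in orderedSimplex w.length, ∏ i : Fin w.length, letterFactor f (w.get i) (x i)

/-- The set `E_W ⊆ [0,1]^k` of feasible tuples of densities of the words `W 0, …, W (k - 1)`. -/
def feasibleSet {k : ℕ} (W : Fin k → List Bool) : Set (Fin k → ℝ) :=
  {δ | (∀ i, δ i ∈ Icc (0 : ℝ) 1) ∧
    ∃ (μ : Measure ℝ) (f : ℝ → ℝ), IsSublebesgue μ f ∧ ∀ i, patternDensity (W i) f = δ i}

end PatternDensity

/-! Up to the factor `k!`, the pattern density is the probability-like mass of increasing tuples
when independent points are drawn from `f dx` for each letter 1 and from `(1 - f) dx` for each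
letter 0. For `0 < ρ < 1`, normalising these to probability measures `α`, `β` extracts the factor
`ρ^m (1-ρ)^n` and leaves the constraint `ρ α + (1-ρ) β = Lebesgue`.

The constraint loses its dependence on `ρ` after a change of variable: any other positive mixture `N
= a' α + b' β` with `a' + b' = 1` has the null sets of Lebesgue measure, and its distribution
function is an increasing map carrying `N` to Lebesgue measure. Order is preserved, hence so is the
mass of increasing tuples (`orderedMass_map`, `exists_reweight`). All `ρ` thus share the normalised
values of the weights `1/2, 1/2`, where a maximum exists by weak compactness and continuity
(`exists_isMaxOn_orderedMass`); this gives `C`. The value 0 comes from the indicator of an interval,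
and the values in between from a segment of densities with the same mean. -/

namespace PatternDensity

open Filter Topology ProbabilityTheory

/-! ### Product laws attached to a word -/

/-- Lebesgue measure on `[0,1]`. -/
noncomputable def lebesgueIcc : Measure ℝ := volume.restrict (Icc (0 : ℝ) 1)

instance : IsProbabilityMeasure lebesgueIcc := ⟨by simp [lebesgueIcc]⟩

instance : NullSingletonClass lebesgueIcc := by
  unfold lebesgueIcc; infer_instance

/-- The measure among `μ`, `ν` that governs the letter `b`. -/
def letterMeasure (μ ν : Measure ℝ) (b : Bool) : Measure ℝ := bif b then μ else ν

section letterMeasure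

variable (μ ν : Measure ℝ) (b : Bool)

instance [IsFiniteMeasure μ] [IsFiniteMeasure ν] : IsFiniteMeasure (letterMeasure μ ν b) := by
  cases b <;> assumption

instance [IsProbabilityMeasure μ] [IsProbabilityMeasure ν] :
    IsProbabilityMeasure (letterMeasure μ ν b) := by
  cases b <;> assumption

instance [NullSingletonClass μ] [NullSingletonClass ν] :
    NullSingletonClass (letterMeasure μ ν b) := by
  cases b <;> assumption

end letterMeasure

/-- The law of independent points, the `i`-th one distributed as `μ` or `ν` according to the
`i`-th letter of `τ`. -/
noncomputable def wordMeasure (τ : List Bool) (μ ν : Measure ℝ) :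
    Measure (Fin τ.length → ℝ) :=
  Measure.pi fun i => letterMeasure μ ν (τ.get i)

/-- The mass of the increasing tuples under `wordMeasure`. -/
noncomputable def orderedMass (τ : List Bool) (μ ν : Measure ℝ) : ℝ :=
  (wordMeasure τ μ ν).real {x | StrictMono x}

theorem isOpen_setOf_strictMono (k : ℕ) : IsOpen {x : Fin k → ℝ | StrictMono x} := by
  have : {x : Fin k → ℝ | StrictMono x} = ⋂ i, ⋂ j, ⋂ _ : i < j, {x | x i < x j} := by
    ext x; simp [StrictMono]
  rw [this]
  exact isOpen_iInter_of_finite fun i => isOpen_iInter_of_finite fun j =>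
    isOpen_iInter_of_finite fun _ => isOpen_lt (continuous_apply i) (continuous_apply j)

theorem measurableSet_setOf_strictMono (k : ℕ) : MeasurableSet {x : Fin k → ℝ | StrictMono x} :=
  (isOpen_setOf_strictMono k).measurableSet

/-! ### Pattern densities as masses of increasing tuples -/

/-- It suffices to compare the two measures on boxes, where the integral of a product factors by
Fubini. -/
theorem pi_withDensity_ofReal {ι : Type*} [Fintype ι] {X : Type*} [MeasurableSpace X]
    (μ : ι → Measure X) [∀ i, SigmaFinite (μ i)] {g : ι → X → ℝ}
    (hg : ∀ i, Integrable (g i) (μ i)) (hg0 : ∀ i, 0 ≤ᵐ[μ i] g i) :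
    Measure.pi (fun i => (μ i).withDensity fun x => ENNReal.ofReal (g i x)) =
      (Measure.pi μ).withDensity fun x => ENNReal.ofReal (∏ i, g i (x i)) := by
  have hfm : ∀ i, IsFiniteMeasure ((μ i).withDensity fun x => ENNReal.ofReal (g i x)) :=
    fun i => isFiniteMeasure_withDensity_ofReal (hg i).2
  have hae : ∀ᵐ x ∂(Measure.pi μ), ∀ i, 0 ≤ g i (x i) :=
    eventually_all.2 fun i => Measure.tendsto_eval_ae_ae.eventually (hg0 i)
  refine Measure.pi_eq fun s hs => ?_
  rw [withDensity_apply _ (MeasurableSet.univ_pi hs), Measure.restrict_pi_pi,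
    ← ofReal_integral_eq_lintegral_ofReal, integral_fintype_prod_eq_prod (𝕜 := ℝ)
      (μ := fun i => (μ i).restrict (s i)),
    ENNReal.ofReal_prod_of_nonneg fun i _ =>
      integral_nonneg_of_ae (ae_restrict_of_ae (hg0 i))]
  · refine Finset.prod_congr rfl fun i _ => ?_
    rw [withDensity_apply _ (hs i), ← ofReal_integral_eq_lintegral_ofReal (hg i).integrableOn
      (ae_restrict_of_ae (hg0 i))]
  · exact Integrable.fintype_prod fun i => (hg i).integrableOn
  · rw [← Measure.restrict_pi_pi]
    refine ae_restrict_of_ae ?_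
    filter_upwards [hae] with x hx
    exact Finset.prod_nonneg fun i _ => hx i

theorem measurable_letterFactor {f : ℝ → ℝ} (hf : Measurable f) (b : Bool) :
    Measurable (letterFactor f b) := by
  cases b
  · exact hf.const_sub 1
  · exact hf

theorem letterFactor_mem_Icc {f : ℝ → ℝ} {x : ℝ} (hf : f x ∈ Icc (0 : ℝ) 1) (b : Bool) :
    letterFactor f b x ∈ Icc (0 : ℝ) 1 := by
  obtain ⟨h0, h1⟩ := hf
  cases b <;> simp [letterFactor, h0, h1]

/-- The measure with density `f` with respect to Lebesgue measure on `[0,1]`. -/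
noncomputable def densityMeasure (f : ℝ → ℝ) : Measure ℝ :=
  lebesgueIcc.withDensity fun x => ENNReal.ofReal (f x)

theorem letterMeasure_densityMeasure (f : ℝ → ℝ) (b : Bool) :
    letterMeasure (densityMeasure f) (densityMeasure fun x => 1 - f x) b =
      densityMeasure (letterFactor f b) := by
  cases b <;> simp [letterMeasure, letterFactor, densityMeasure]

theorem ae_lebesgueIcc {p : ℝ → Prop} (h : ∀ x ∈ Icc (0 : ℝ) 1, p x) : ∀ᵐ x ∂lebesgueIcc, p x :=
  ae_restrict_of_forall_mem measurableSet_Icc h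

theorem integrable_lebesgueIcc {f : ℝ → ℝ} (hf : Measurable f)
    (hf01 : ∀ x ∈ Icc (0 : ℝ) 1, f x ∈ Icc (0 : ℝ) 1) : Integrable f lebesgueIcc :=
  Integrable.of_bound hf.aestronglyMeasurable 1 <| ae_lebesgueIcc fun x hx => by
    rw [Real.norm_eq_abs, abs_of_nonneg (hf01 x hx).1]; exact (hf01 x hx).2

theorem isFiniteMeasure_densityMeasure {f : ℝ → ℝ} (hf : Measurable f)
    (hf01 : ∀ x ∈ Icc (0 : ℝ) 1, f x ∈ Icc (0 : ℝ) 1) : IsFiniteMeasure (densityMeasure f) :=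
  isFiniteMeasure_withDensity_ofReal (integrable_lebesgueIcc hf hf01).2

theorem orderedSimplex_eq (k : ℕ) :
    orderedSimplex k = {x : Fin k → ℝ | StrictMono x} ∩ univ.pi fun _ => Icc (0 : ℝ) 1 := by
  ext x; simp only [orderedSimplex, mem_ofPred_eq, mem_inter_iff, mem_univ_pi]; tauto

theorem volume_restrict_orderedSimplex (k : ℕ) :
    (volume : Measure (Fin k → ℝ)).restrict (orderedSimplex k) =
      (Measure.pi fun _ => lebesgueIcc).restrict {x : Fin k → ℝ | StrictMono x} := by
  rw [orderedSimplex_eq, ← Measure.restrict_restrict (measurableSet_setOf_strictMono k),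
    volume_pi, Measure.restrict_pi_pi]
  rfl

theorem ae_pi_lebesgueIcc (k : ℕ) :
    ∀ᵐ x ∂(Measure.pi fun _ : Fin k => lebesgueIcc), ∀ i, x i ∈ Icc (0 : ℝ) 1 :=
  eventually_all.2 fun _ => Measure.tendsto_eval_ae_ae.eventually (ae_lebesgueIcc fun _ h => h)

/-- The pattern density as the probability-like mass of increasing tuples. -/
theorem patternDensity_eq {f : ℝ → ℝ} (hf : Measurable f)
    (hf01 : ∀ x ∈ Icc (0 : ℝ) 1, f x ∈ Icc (0 : ℝ) 1) (τ : List Bool) :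
    patternDensity τ f = τ.length.factorial *
      orderedMass τ (densityMeasure f) (densityMeasure fun x => 1 - f x) := by
  have hm := measurableSet_setOf_strictMono τ.length
  have h01 : ∀ᵐ x ∂(Measure.pi fun _ : Fin τ.length => lebesgueIcc),
      0 ≤ ∏ i, letterFactor f (τ.get i) (x i) := by
    filter_upwards [ae_pi_lebesgueIcc τ.length] with x hx
    exact Finset.prod_nonneg fun i _ => (letterFactor_mem_Icc (hf01 _ (hx i)) _).1
  rw [patternDensity, volume_restrict_orderedSimplex, orderedMass, wordMeasure]
  simp_rw [letterMeasure_densityMeasure, densityMeasure]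
  rw [pi_withDensity_ofReal (fun _ : Fin τ.length => lebesgueIcc)
    (g := fun i => letterFactor f (τ.get i))
    (fun i => integrable_lebesgueIcc (measurable_letterFactor hf _)
      fun x hx => letterFactor_mem_Icc (hf01 x hx) _)
    (fun i => ae_lebesgueIcc fun x hx => (letterFactor_mem_Icc (hf01 x hx) _).1),
    measureReal_def, withDensity_apply _ hm, integral_eq_lintegral_of_nonneg_ae
      (ae_restrict_of_ae h01)]
  exact (Finset.measurable_prod _ fun i _ =>
    (measurable_letterFactor hf _).comp (measurable_pi_apply i)).aestronglyMeasurable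

/-! ### Scaling and total mass -/

theorem prod_letter {M : Type*} [CommMonoid M] (τ : List Bool) (a b : M) :
    ∏ i : Fin τ.length, (bif τ.get i then a else b) =
      a ^ τ.count true * b ^ τ.count false := by
  induction τ with
  | nil => simp
  | cons c τ ih =>
    refine (Fin.prod_univ_succ (n := τ.length) fun i => bif (c :: τ).get i then a else b).trans ?_
    refine (congrArg _ ih).trans ?_
    cases c <;> simp [pow_succ] <;> ac_rfl

theorem wordMeasure_smul (τ : List Bool) (a b : NNReal) (μ ν : Measure ℝ) [IsFiniteMeasure μ]
    [IsFiniteMeasure ν] :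
    wordMeasure τ (a • μ) (b • ν) =
      (a ^ τ.count true * b ^ τ.count false) • wordMeasure τ μ ν := by
  refine Measure.pi_eq fun s hs => ?_
  have : ∀ i, letterMeasure (a • μ) (b • ν) (τ.get i) (s i) =
      ((bif τ.get i then a else b : NNReal) : ENNReal) * letterMeasure μ ν (τ.get i) (s i) := by
    intro i
    cases τ.get i <;> rfl
  rw [Finset.prod_congr rfl fun i _ => this i, Finset.prod_mul_distrib,
    ← ENNReal.ofNNReal_finsetProd, prod_letter, Measure.smul_apply, wordMeasure, Measure.pi_pi,
    ENNReal.smul_def, smul_eq_mul]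

theorem orderedMass_smul (τ : List Bool) (a b : NNReal) (μ ν : Measure ℝ) [IsFiniteMeasure μ]
    [IsFiniteMeasure ν] :
    orderedMass τ (a • μ) (b • ν) =
      a ^ τ.count true * b ^ τ.count false * orderedMass τ μ ν := by
  rw [orderedMass, wordMeasure_smul, measureReal_nnreal_smul_apply, orderedMass]
  push_cast
  rfl

theorem orderedMass_nonneg (τ : List Bool) (μ ν : Measure ℝ) : 0 ≤ orderedMass τ μ ν :=
  measureReal_nonneg

theorem orderedMass_le (τ : List Bool) (μ ν : Measure ℝ) [IsFiniteMeasure μ]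
    [IsFiniteMeasure ν] :
    orderedMass τ μ ν ≤ μ.real univ ^ τ.count true * ν.real univ ^ τ.count false := by
  have h : (wordMeasure τ μ ν).real univ =
      μ.real univ ^ τ.count true * ν.real univ ^ τ.count false := by
    rw [measureReal_def, wordMeasure, Measure.pi_univ, ENNReal.toReal_prod, ← prod_letter]
    refine Finset.prod_congr rfl fun i _ => ?_
    cases τ.get i <;> simp [letterMeasure, measureReal_def]
  have : IsFiniteMeasure (wordMeasure τ μ ν) := by unfold wordMeasure; infer_instance
  exact h ▸ measureReal_mono (subset_univ _)

theorem patternDensity_true (f : ℝ → ℝ) : patternDensity [true] f = ∫ x, f x ∂lebesgueIcc := by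
  rw [patternDensity, volume_restrict_orderedSimplex]
  have : {x : Fin [true].length → ℝ | StrictMono x} = univ := by
    ext x; exact iff_of_true (fun i j (h : i < j) =>
      absurd h (by rw [Subsingleton.elim (α := Fin 1) i j]; exact lt_irrefl _)) trivial
  rw [this, Measure.restrict_univ]
  have := integral_fintype_prod_eq_prod (𝕜 := ℝ) (fun i : Fin [true].length =>
    letterFactor f ([true].get i)) (μ := fun _ => lebesgueIcc)
  rw [this]
  simp [letterFactor]

theorem densityMeasure_real_univ {f : ℝ → ℝ} (hf : Measurable f)
    (hf01 : ∀ x ∈ Icc (0 : ℝ) 1, f x ∈ Icc (0 : ℝ) 1) :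
    (densityMeasure f).real univ = ∫ x, f x ∂lebesgueIcc := by
  rw [measureReal_def, densityMeasure, withDensity_apply _ MeasurableSet.univ,
    Measure.restrict_univ, integral_eq_lintegral_of_nonneg_ae
      (ae_lebesgueIcc fun x hx => (hf01 x hx).1) hf.aestronglyMeasurable]

/-! ### Densities versus pairs of measures with sum Lebesgue -/

theorem densityMeasure_add_compl {f : ℝ → ℝ} (hf : Measurable f)
    (hf01 : ∀ x ∈ Icc (0 : ℝ) 1, f x ∈ Icc (0 : ℝ) 1) :
    densityMeasure f + densityMeasure (fun x => 1 - f x) = lebesgueIcc := by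
  rw [densityMeasure, densityMeasure, ← withDensity_add_left (by fun_prop)]
  have : (fun x => ENNReal.ofReal (f x)) + (fun x => ENNReal.ofReal (1 - f x)) =ᵐ[lebesgueIcc]
      1 := ae_lebesgueIcc fun x hx => by
    rw [Pi.add_apply, ← ENNReal.ofReal_add (hf01 x hx).1 (sub_nonneg.2 (hf01 x hx).2)]
    simp
  rw [withDensity_congr_ae this, withDensity_one]

/-- Two measures that add up to Lebesgue measure on `[0,1]` have densities `f` and `1 - f`. -/
theorem exists_density {μ ν : Measure ℝ} (h : μ + ν = lebesgueIcc) :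
    ∃ f : ℝ → ℝ, Measurable f ∧ (∀ x, f x ∈ Icc (0 : ℝ) 1) ∧ densityMeasure f = μ ∧
      densityMeasure (fun x => 1 - f x) = ν := by
  have hμ : μ ≤ lebesgueIcc := h ▸ Measure.le_add_right le_rfl
  have hfin : IsFiniteMeasure μ := isFiniteMeasure_of_le _ hμ
  -- The derivative is at most 1 only almost everywhere; truncating puts `f` in `[0,1]` everywhere.
  let f : ℝ → ℝ := fun x => min (μ.rnDeriv lebesgueIcc x).toReal 1
  have hf : Measurable f := (Measure.measurable_rnDeriv _ _).ennreal_toReal.min measurable_const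
  have hf01 : ∀ x, f x ∈ Icc (0 : ℝ) 1 := fun x =>
    ⟨le_min ENNReal.toReal_nonneg zero_le_one, min_le_right _ _⟩
  have hfμ : densityMeasure f = μ := by
    rw [← Measure.withDensity_rnDeriv_eq μ lebesgueIcc (Measure.absolutelyContinuous_of_le hμ),
      densityMeasure]
    refine withDensity_congr_ae ?_
    filter_upwards [Measure.rnDeriv_le_one_of_le hμ] with x hx
    have hx' : (μ.rnDeriv lebesgueIcc x).toReal ≤ 1 :=
      ENNReal.toReal_le_of_le_ofReal zero_le_one (by simpa using hx)
    simp only [f, min_eq_left hx']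
    exact ENNReal.ofReal_toReal (ne_top_of_le_ne_top ENNReal.one_ne_top hx)
  refine ⟨f, hf, hf01, hfμ, ?_⟩
  have := densityMeasure_add_compl hf fun x _ => hf01 x
  rw [← h, hfμ] at this
  ext s hs
  have hs' := congrArg (fun m => m s) this
  simp only [Measure.add_apply] at hs'
  exact (ENNReal.add_right_inj (measure_ne_top μ s)).1 hs'

/-! ### Compactness, continuity and the maximum -/

/-- Two coordinates are independent, and every slice of the diagonal is a point, null for an
atomless law. -/
theorem wordMeasure_diagonal (τ : List Bool) (μ ν : Measure ℝ) [IsProbabilityMeasure μ]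
    [IsProbabilityMeasure ν] [NullSingletonClass μ] [NullSingletonClass ν] {i j : Fin τ.length}
    (hij : i ≠ j) : wordMeasure τ μ ν {x | x i = x j} = 0 := by
  have hind : IndepFun (fun x : Fin τ.length → ℝ => x i) (fun x => x j) (wordMeasure τ μ ν) :=
    (iIndepFun_pi (μ := fun i => letterMeasure μ ν (τ.get i)) (X := fun _ x => x)
      fun _ => aemeasurable_id).indepFun hij
  have hmap : ∀ i, (wordMeasure τ μ ν).map (fun x => x i) = letterMeasure μ ν (τ.get i) :=
    fun i => (measurePreserving_eval (fun i => letterMeasure μ ν (τ.get i)) i).map_eq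
  have hp : IsProbabilityMeasure (wordMeasure τ μ ν) := by unfold wordMeasure; infer_instance
  have hprod := (indepFun_iff_map_prod_eq_prod_map_map (measurable_pi_apply i).aemeasurable
    (measurable_pi_apply j).aemeasurable).1 hind
  have hD : MeasurableSet {p : ℝ × ℝ | p.1 = p.2} :=
    measurableSet_eq_fun (by fun_prop) (by fun_prop)
  have : {x : Fin τ.length → ℝ | x i = x j} =
    (fun x => (x i, x j)) ⁻¹' {p : ℝ × ℝ | p.1 = p.2} := rfl
  rw [this, ← Measure.map_apply (by fun_prop) hD, hprod, hmap, hmap, Measure.measure_prod_null hD]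
  refine Eventually.of_forall fun x => ?_
  have : Prod.mk x ⁻¹' {p : ℝ × ℝ | p.1 = p.2} = {x} := by ext y; simp [eq_comm]
  simp only [this, measure_singleton, Pi.zero_apply]

/-- A limit of increasing tuples is monotone, so one that is not strictly increasing has two equal
coordinates. -/
theorem wordMeasure_frontier (τ : List Bool) (μ ν : Measure ℝ) [IsProbabilityMeasure μ]
    [IsProbabilityMeasure ν] [NullSingletonClass μ] [NullSingletonClass ν] :
    wordMeasure τ μ ν (frontier {x | StrictMono x}) = 0 := by
  have hcl : closure {x : Fin τ.length → ℝ | StrictMono x} ⊆ {x | Monotone x} := by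
    refine closure_minimal (fun x (hx : StrictMono x) => hx.monotone) ?_
    exact isClosed_monotone
  have hsub : frontier {x : Fin τ.length → ℝ | StrictMono x} ⊆
      ⋃ i, ⋃ j, ⋃ _ : i ≠ j, {x | x i = x j} := by
    intro x hx
    rw [(isOpen_setOf_strictMono _).frontier_eq] at hx
    by_contra h
    simp only [mem_iUnion, not_exists] at h
    exact hx.2 (Monotone.strictMono_of_injective (hcl hx.1) fun i j hij =>
      by_contra fun hne => h i j hne hij)
  refine measure_mono_null hsub ?_
  simp only [measure_iUnion_null_iff]
  exact fun i j hij => wordMeasure_diagonal τ μ ν hij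

/-- The pairs of probability measures whose average is Lebesgue measure on `[0,1]`. -/
def fairPairs : Set (ProbabilityMeasure ℝ × ProbabilityMeasure ℝ) :=
  {p | (p.1 : Measure ℝ) + p.2 = (2 : NNReal) • lebesgueIcc}

theorem nullSingletonClass_of_le {X : Type*} [MeasurableSpace X] {μ ν : Measure X}
    [NullSingletonClass ν] (h : μ ≤ ν) : NullSingletonClass μ :=
  ⟨fun x => le_antisymm ((h {x}).trans (measure_singleton x).le) zero_le⟩

/-- Both components live on `[0,1]`, hence are tight and Prokhorov applies. The condition on the sum
is weakly closed because bounded continuous functions test it. -/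
theorem isCompact_fairPairs : IsCompact fairPairs := by
  let K : Set (ProbabilityMeasure ℝ) := {μ | (μ : Measure ℝ) (Icc 0 1)ᶜ = 0}
  have hK : IsCompact (closure K) := by
    refine isCompact_closure_of_isTightMeasureSet ?_
    rw [isTightMeasureSet_iff_exists_isCompact_measure_compl_le]
    intro ε _
    refine ⟨Icc 0 1, isCompact_Icc, ?_⟩
    rintro _ ⟨μ, hμ, rfl⟩
    exact (show (μ : Measure ℝ) (Icc 0 1)ᶜ = 0 from hμ).le.trans zero_le
  refine (hK.prod hK).of_isClosed_subset ?_ ?_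
  · have : fairPairs = ⋂ g : BoundedContinuousFunction ℝ ℝ,
        {p | ∫ x, g x ∂(p.1 : Measure ℝ) + ∫ x, g x ∂(p.2 : Measure ℝ) =
          ∫ x, g x ∂((2 : NNReal) • lebesgueIcc)} := by
      ext p
      simp only [fairPairs, mem_ofPred_eq, mem_iInter]
      have hadd : ∀ g : BoundedContinuousFunction ℝ ℝ,
          ∫ x, g x ∂((p.1 : Measure ℝ) + (p.2 : Measure ℝ)) =
            ∫ x, g x ∂(p.1 : Measure ℝ) + ∫ x, g x ∂(p.2 : Measure ℝ) :=
        fun g => integral_add_measure (g.integrable _) (g.integrable _)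
      simp_rw [← hadd]
      exact ⟨fun h g => by rw [h], ext_of_forall_integral_eq_of_IsFiniteMeasure⟩
    rw [this]
    refine isClosed_iInter fun g => isClosed_eq (.add ?_ ?_) continuous_const
    · exact (ProbabilityMeasure.continuous_integral_boundedContinuousFunction g).comp continuous_fst
    · exact (ProbabilityMeasure.continuous_integral_boundedContinuousFunction g).comp continuous_snd
  · intro p hp
    have hz : ((p.1 : Measure ℝ) + (p.2 : Measure ℝ)) (Icc 0 1)ᶜ = 0 := by
      rw [show (p.1 : Measure ℝ) + (p.2 : Measure ℝ) = _ from hp, lebesgueIcc]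
      simp [measurableSet_Icc]
    rw [Measure.add_apply, add_eq_zero] at hz
    exact ⟨subset_closure hz.1, subset_closure hz.2⟩

/-- Finite products are weakly continuous. On `fairPairs` both measures are atomless, so the
increasing tuples have null frontier and the portmanteau theorem applies. -/
theorem continuousOn_orderedMass (τ : List Bool) :
    ContinuousOn (fun p : ProbabilityMeasure ℝ × ProbabilityMeasure ℝ => orderedMass τ p.1 p.2)
      fairPairs := by
  intro p hp
  refine ContinuousAt.continuousWithinAt ?_
  have h2 : NullSingletonClass ((2 : NNReal) • lebesgueIcc) := ⟨fun x => by simp⟩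
  have hp' : (p.1 : Measure ℝ) + p.2 = (2 : NNReal) • lebesgueIcc := hp
  have h1 : NullSingletonClass (p.1 : Measure ℝ) :=
    nullSingletonClass_of_le (hp' ▸ Measure.le_add_right le_rfl)
  have h2 : NullSingletonClass (p.2 : Measure ℝ) :=
    nullSingletonClass_of_le (hp' ▸ Measure.le_add_left le_rfl)
  let F : ProbabilityMeasure ℝ × ProbabilityMeasure ℝ → ProbabilityMeasure (Fin τ.length → ℝ) :=
    fun q => ProbabilityMeasure.pi fun i => bif τ.get i then q.1 else q.2
  have hF : Continuous F := by
    refine ProbabilityMeasure.continuous_pi.comp (continuous_pi fun i => ?_)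
    cases τ.get i
    · exact continuous_snd
    · exact continuous_fst
  have hFq : ∀ q, (F q : Measure (Fin τ.length → ℝ)) = wordMeasure τ q.1 q.2 := fun q => by
    refine congrArg Measure.pi (funext fun i => ?_)
    beta_reduce
    cases τ.get i <;> rfl
  have := ProbabilityMeasure.tendsto_measure_of_null_frontier_of_tendsto' (hF.tendsto p)
    (E := {x | StrictMono x}) (by rw [hFq]; exact wordMeasure_frontier τ _ _)
  simp_rw [hFq] at this
  exact (ENNReal.tendsto_toReal (by rw [← hFq]; exact measure_ne_top _ _)).comp this

theorem exists_isMaxOn_orderedMass (τ : List Bool) :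
    ∃ p ∈ fairPairs, ∀ q ∈ fairPairs, orderedMass τ q.1 q.2 ≤ orderedMass τ p.1 p.2 := by
  have hne : fairPairs.Nonempty :=
    ⟨(⟨lebesgueIcc, inferInstance⟩, ⟨lebesgueIcc, inferInstance⟩), by
      change lebesgueIcc + lebesgueIcc = _
      ext s hs
      simp [ENNReal.smul_def, two_mul]⟩
  exact isCompact_fairPairs.exists_isMaxOn hne (continuousOn_orderedMass τ)

/-! ### Increasing reparametrization and change of weights -/

/-- Increasing reparametrizations of the line preserve the mass of the increasing tuples. -/
theorem orderedMass_map (τ : List Bool) {μ ν : Measure ℝ} [IsFiniteMeasure μ] [IsFiniteMeasure ν]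
    {s : Set ℝ} {H : ℝ → ℝ} (hH : Measurable H) (hs : StrictMonoOn H s)
    (hμ : ∀ᵐ x ∂μ, x ∈ s) (hν : ∀ᵐ x ∂ν, x ∈ s) :
    orderedMass τ (μ.map H) (ν.map H) = orderedMass τ μ ν := by
  have hl : ∀ i, letterMeasure (μ.map H) (ν.map H) (τ.get i) =
      (letterMeasure μ ν (τ.get i)).map H := fun i => by cases τ.get i <;> rfl
  have hmap : wordMeasure τ (μ.map H) (ν.map H) =
      (wordMeasure τ μ ν).map fun x i => H (x i) := by
    rw [wordMeasure, wordMeasure, Measure.pi_map_pi fun _ => hH.aemeasurable]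
    simp_rw [hl]
  have hae : ∀ᵐ x ∂(wordMeasure τ μ ν), ∀ i, x i ∈ s :=
    eventually_all.2 fun i => Measure.tendsto_eval_ae_ae.eventually (by
      cases τ.get i
      · exact hν
      · exact hμ)
  have hHm : Measurable fun (x : Fin τ.length → ℝ) i => H (x i) :=
    measurable_pi_lambda _ fun i => hH.comp (measurable_pi_apply i)
  rw [orderedMass, hmap, map_measureReal_apply hHm (measurableSet_setOf_strictMono _), orderedMass]
  refine measureReal_congr ?_
  filter_upwards [hae] with x hx
  refine propext ⟨fun h i j hij => ?_, fun h i j hij => ?_⟩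
  · exact (hs.lt_iff_lt (hx i) (hx j)).1 (h hij)
  · exact (hs.lt_iff_lt (hx i) (hx j)).2 (h hij)

theorem continuous_cdf (μ : Measure ℝ) [IsProbabilityMeasure μ] [NullSingletonClass μ] :
    Continuous (cdf μ) := by
  refine continuous_iff_continuousAt.2 fun x => ?_
  rw [(monotone_cdf μ).continuousAt_iff_leftLim_eq_rightLim, StieltjesFunction.rightLim_eq]
  have h := (cdf μ).measure_singleton x
  rw [measure_cdf, measure_singleton] at h
  have := ENNReal.ofReal_eq_zero.1 h.symm
  exact le_antisymm ((monotone_cdf μ).leftLim_le le_rfl) (by linarith)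

theorem strictMonoOn_cdf {μ : Measure ℝ} [IsProbabilityMeasure μ]
    (h : lebesgueIcc ≪ μ) : StrictMonoOn (cdf μ) (Icc 0 1) := by
  intro x hx y hy hxy
  have hsub : Ioc x y ⊆ Icc 0 1 := fun z hz => ⟨hx.1.trans hz.1.le, hz.2.trans hy.2⟩
  have hpos : lebesgueIcc (Ioc x y) ≠ 0 := by
    rw [lebesgueIcc, Measure.restrict_apply measurableSet_Ioc, inter_eq_left.2 hsub]
    simpa using hxy
  have hpos' : μ (Ioc x y) ≠ 0 := fun h0 => hpos (h h0)
  rw [← measure_cdf μ, StieltjesFunction.measure_Ioc] at hpos'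
  have := ENNReal.ofReal_pos.1 (pos_iff_ne_zero.2 hpos')
  linarith

/-- A measure with the null sets of Lebesgue measure on `[0,1]` is transported to the latter by
its distribution function. -/
theorem map_cdf {μ : Measure ℝ} [IsProbabilityMeasure μ]
    (h : lebesgueIcc ≪ μ) (h' : μ ≪ lebesgueIcc) : μ.map (cdf μ) = lebesgueIcc := by
  have hna : NullSingletonClass μ := ⟨fun x => h' (measure_singleton x)⟩
  have hcont := continuous_cdf μ
  have hmono := strictMonoOn_cdf h
  have hIcc : ∀ᵐ x ∂μ, x ∈ Icc (0 : ℝ) 1 := h'.ae_le (ae_lebesgueIcc fun _ hx => hx)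
  have hIcc0 : μ (Icc 0 1)ᶜ = 0 := hIcc
  have h0 : cdf μ 0 = 0 := by
    have : μ (Iic 0) = 0 := by
      rw [← measure_congr (Iio_ae_eq_Iic (μ := μ) (a := (0 : ℝ)))]
      have hsub : Iio (0 : ℝ) ⊆ (Icc 0 1)ᶜ := fun x hx hx' => (mem_Iio.1 hx).not_ge hx'.1
      exact measure_mono_null hsub hIcc0
    rw [cdf_eq_real, measureReal_def, this, ENNReal.toReal_zero]
  have h1 : cdf μ 1 = 1 := by
    rw [cdf_eq_real, measureReal_def, (prob_compl_eq_zero_iff measurableSet_Iic).1,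
      ENNReal.toReal_one]
    exact measure_mono_null (compl_subset_compl.2 fun x hx => hx.2) hIcc0
  have : IsProbabilityMeasure (μ.map (cdf μ)) :=
    Measure.isProbabilityMeasure_map hcont.measurable.aemeasurable
  refine Measure.ext_of_Iic _ _ fun y => ?_
  rw [Measure.map_apply hcont.measurable measurableSet_Iic]
  have hL : ∀ y ∈ Icc (0 : ℝ) 1, lebesgueIcc (Iic y) = ENNReal.ofReal y := fun y hy => by
    have : Iic y ∩ Icc 0 1 = Icc 0 y := by
      ext z; simp only [mem_inter_iff, mem_Iic, mem_Icc]
      exact ⟨fun hz => ⟨hz.2.1, hz.1⟩, fun hz => ⟨hz.2, hz.1, hz.2.trans hy.2⟩⟩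
    rw [lebesgueIcc, Measure.restrict_apply measurableSet_Iic, this, Real.volume_Icc, sub_zero]
  rcases lt_or_ge y 0 with hy0 | hy0
  · have he : cdf μ ⁻¹' Iic y = ∅ :=
      eq_empty_of_forall_notMem fun x hx => (hy0.trans_le (cdf_nonneg μ x)).not_ge hx
    rw [he, measure_empty]
    refine (measure_mono_null (Iic_subset_Iic.2 hy0.le) ?_).symm
    rw [hL 0 ⟨le_rfl, zero_le_one⟩, ENNReal.ofReal_zero]
  rcases lt_or_ge 1 y with hy1 | hy1
  · have he : cdf μ ⁻¹' Iic y = univ :=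
      eq_univ_of_forall fun x => (cdf_le_one μ x).trans hy1.le
    rw [he, measure_univ]
    refine le_antisymm ?_ prob_le_one
    have := measure_mono (μ := lebesgueIcc) (Iic_subset_Iic.2 hy1.le)
    rwa [hL 1 ⟨zero_le_one, le_rfl⟩, ENNReal.ofReal_one] at this
  -- Write `y = cdf μ x`; by strict monotonicity, `cdf μ z ≤ y` means `z ≤ x` for almost every `z`.
  · obtain ⟨x, hx, rfl⟩ := intermediate_value_Icc zero_le_one hcont.continuousOn
      (show y ∈ Icc (cdf μ 0) (cdf μ 1) by rw [h0, h1]; exact ⟨hy0, hy1⟩)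
    rw [hL _ ⟨hy0, hy1⟩, ofReal_cdf]
    refine measure_congr ?_
    filter_upwards [hIcc] with z hz
    exact propext (hmono.le_iff_le hz hx)

/-- The weights `a`, `b` with which two probability measures average to Lebesgue measure on
`[0,1]` can be changed without changing the mass of the increasing tuples. -/
theorem exists_reweight (τ : List Bool) {a b a' b' : NNReal} (ha : a ≠ 0) (hb : b ≠ 0)
    (ha' : a' ≠ 0) (hb' : b' ≠ 0) (hab' : a' + b' = 1) {α β : Measure ℝ}
    [IsProbabilityMeasure α] [IsProbabilityMeasure β] (h : a • α + b • β = lebesgueIcc) :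
    ∃ α' β' : Measure ℝ, IsProbabilityMeasure α' ∧ IsProbabilityMeasure β' ∧
      a' • α' + b' • β' = lebesgueIcc ∧ orderedMass τ α' β' = orderedMass τ α β := by
  have hnull : ∀ {a b : NNReal}, a ≠ 0 → b ≠ 0 → ∀ s,
      (a • α + b • β) s = 0 ↔ α s = 0 ∧ β s = 0 := fun {a b} ha hb s => by
    rw [Measure.add_apply, add_eq_zero, Measure.smul_apply, Measure.smul_apply,
      ENNReal.smul_def, ENNReal.smul_def, smul_eq_mul, smul_eq_mul, mul_eq_zero, mul_eq_zero,
      ENNReal.coe_eq_zero, ENNReal.coe_eq_zero, or_iff_right ha, or_iff_right hb]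
  -- All weights being nonzero, `N` and Lebesgue measure both have as null sets the common null sets
  -- of `α` and `β`; hence `cdf N` transports `N` to Lebesgue measure.
  let N := a' • α + b' • β
  have hN : IsProbabilityMeasure N := ⟨by
    simp only [N, Measure.add_apply, Measure.smul_apply, measure_univ, ENNReal.smul_def,
      smul_eq_mul, mul_one]
    exact_mod_cast hab'⟩
  have h1 : lebesgueIcc ≪ N := fun s hs => by
    rw [← h, hnull ha hb]; exact (hnull ha' hb' s).1 hs
  have h2 : N ≪ lebesgueIcc := fun s hs => by
    rw [← h, hnull ha hb] at hs; exact (hnull ha' hb' s).2 hs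
  have hIcc : N (Icc 0 1)ᶜ = 0 := h2.ae_le (ae_lebesgueIcc fun _ hx => hx)
  obtain ⟨hα, hβ⟩ := (hnull ha' hb' _).1 hIcc
  have hm : Measurable (cdf N) := (monotone_cdf N).measurable
  refine ⟨α.map (cdf N), β.map (cdf N), Measure.isProbabilityMeasure_map hm.aemeasurable,
    Measure.isProbabilityMeasure_map hm.aemeasurable, ?_,
    orderedMass_map τ hm (strictMonoOn_cdf h1) hα hβ⟩
  rw [← map_cdf h1 h2]
  simp only [N, Measure.map_add _ _ hm, Measure.map_smul]

/-! ### A priori bound, the value zero, and segments of densities -/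

/-- The `k!` orderings of a `k`-tuple of distinct points are equally likely. -/
theorem factorial_mul_pi_strictMono_le_one (μ : Measure ℝ) [IsProbabilityMeasure μ] (k : ℕ) :
    k.factorial * (Measure.pi fun _ : Fin k => μ).real {x | StrictMono x} ≤ 1 := by
  let P := Measure.pi fun _ : Fin k => μ
  let S : Equiv.Perm (Fin k) → Set (Fin k → ℝ) := fun σ =>
    (MeasurableEquiv.piCongrLeft (fun _ => ℝ) σ) ⁻¹' {x | StrictMono x}
  have hcoe : ∀ (σ : Equiv.Perm (Fin k)) (x : Fin k → ℝ),
      MeasurableEquiv.piCongrLeft (fun _ => ℝ) σ x = x ∘ σ.symm := fun σ x => by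
    funext i
    obtain ⟨j, rfl⟩ := σ.surjective i
    rw [MeasurableEquiv.coe_piCongrLeft, Equiv.piCongrLeft_apply_apply]
    simp
  have hS : ∀ σ, P (S σ) = P {x | StrictMono x} := fun σ =>
    (measurePreserving_piCongrLeft (fun _ : Fin k => μ) σ).measure_preimage
      (measurableSet_setOf_strictMono k).nullMeasurableSet
  have hSm : ∀ σ, MeasurableSet (S σ) := fun σ =>
    (MeasurableEquiv.measurable _) (measurableSet_setOf_strictMono k)
  have hd : Pairwise (Function.onFun Disjoint S) := by
    intro σ σ' hne
    refine disjoint_left.2 fun x hx hx' => hne ?_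
    have h1 : StrictMono (x ∘ σ.symm) := hcoe σ x ▸ hx
    have h2 : StrictMono (x ∘ σ'.symm) := hcoe σ' x ▸ hx'
    have hinj : Function.Injective x := by
      have := h1.injective.comp σ.injective
      rwa [Function.comp_assoc, Equiv.symm_comp_self, Function.comp_id] at this
    -- Strictly increasing tuples with the same range coincide.
    have h3 : x ∘ σ.symm = x ∘ σ'.symm := by
      refine (h1.range_inj h2).1 ?_
      rw [σ.symm.surjective.range_comp, σ'.symm.surjective.range_comp]
    have h4 : σ.symm = σ'.symm := Equiv.ext fun i => hinj (congrFun h3 i)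
    rw [← σ.symm_symm, h4, σ'.symm_symm]
  have hsum : ∑ σ, P.real (S σ) ≤ 1 := by
    have := measureReal_biUnion_finset (μ := P) (s := Finset.univ) (f := S)
      (fun σ _ σ' _ h => hd h) fun σ _ => hSm σ
    rw [← this]
    exact measureReal_le_one
  simp_rw [measureReal_def, hS] at hsum
  simpa [Fintype.card_perm, measureReal_def] using hsum

/-- Needed because `feasibleSet` requires its coordinates to lie in `[0,1]`. -/
theorem patternDensity_le_one {f : ℝ → ℝ} (hf01 : ∀ x ∈ Icc (0 : ℝ) 1, f x ∈ Icc (0 : ℝ) 1)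
    (τ : List Bool) : patternDensity τ f ≤ 1 := by
  refine le_trans ?_ (factorial_mul_pi_strictMono_le_one lebesgueIcc τ.length)
  rw [patternDensity, volume_restrict_orderedSimplex]
  gcongr
  calc _ ≤ ∫ x in {x : Fin τ.length → ℝ | StrictMono x}, (1 : ℝ)
        ∂(Measure.pi fun _ => lebesgueIcc) := by
        refine integral_mono_of_nonneg (ae_restrict_of_ae ?_) (integrable_const _)
          (ae_restrict_of_ae ?_)
        · filter_upwards [ae_pi_lebesgueIcc τ.length] with x hx
          exact Finset.prod_nonneg fun i _ => (letterFactor_mem_Icc (hf01 _ (hx i)) _).1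
        · filter_upwards [ae_pi_lebesgueIcc τ.length] with x hx
          exact Finset.prod_le_one (fun i _ => (letterFactor_mem_Icc (hf01 _ (hx i)) _).1)
            fun i _ => (letterFactor_mem_Icc (hf01 _ (hx i)) _).2
    _ = _ := by simp [measureReal_def]

/-- Dominated convergence: the integrand is polynomial in `t` and bounded by 1. -/
theorem continuousOn_patternDensity_segment {f g : ℝ → ℝ} (hf : Measurable f) (hg : Measurable g)
    (hfg : ∀ t ∈ Icc (0 : ℝ) 1, ∀ x, (1 - t) * f x + t * g x ∈ Icc (0 : ℝ) 1) (τ : List Bool) :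
    ContinuousOn (fun t : ℝ => patternDensity τ fun x => (1 - t) * f x + t * g x) (Icc 0 1) := by
  simp only [patternDensity, volume_restrict_orderedSimplex]
  refine continuousOn_const.mul (continuousOn_of_dominated (bound := fun _ => 1) ?_ ?_
    (integrable_const _) ?_)
  · exact fun t _ => (Finset.measurable_prod _ fun i _ => (measurable_letterFactor
      (by fun_prop) _).comp (measurable_pi_apply i)).aestronglyMeasurable
  · refine fun t ht => Eventually.of_forall fun x => ?_
    have h := fun i => letterFactor_mem_Icc (f := fun x => (1 - t) * f x + t * g x)
      (hfg t ht (x i)) (τ.get i)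
    rw [Real.norm_eq_abs, abs_of_nonneg (Finset.prod_nonneg fun i _ => (h i).1)]
    exact Finset.prod_le_one (fun i _ => (h i).1) fun i _ => (h i).2
  · refine Eventually.of_forall fun x => Continuous.continuousOn ?_
    refine continuous_finsetProd _ fun i _ => ?_
    unfold letterFactor
    split_ifs <;> fun_prop

/-- Choose a 1 and a 0 in the word. If the 1 comes first, let `f` be the indicator of the right end
of `[0,1]`, otherwise of the left end: a point of the interval at the 1 forces one at the 0, so some
factor vanishes. -/
theorem exists_patternDensity_eq_zero {τ : List Bool} (h1 : true ∈ τ) (h0 : false ∈ τ) {ρ : ℝ}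
    (hρ : ρ ∈ Icc (0 : ℝ) 1) :
    ∃ f : ℝ → ℝ, Measurable f ∧ (∀ x, f x ∈ Icc (0 : ℝ) 1) ∧ ∫ x, f x ∂lebesgueIcc = ρ ∧
      patternDensity τ f = 0 := by
  obtain ⟨i, hi⟩ := List.mem_iff_get.1 h1
  obtain ⟨j, hj⟩ := List.mem_iff_get.1 h0
  have key : ∀ s : Set ℝ, MeasurableSet s → lebesgueIcc.real s = ρ →
      (∀ x ∈ orderedSimplex τ.length, x i ∈ s → x j ∈ s) →
      ∃ f : ℝ → ℝ, Measurable f ∧ (∀ x, f x ∈ Icc (0 : ℝ) 1) ∧ ∫ x, f x ∂lebesgueIcc = ρ ∧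
        patternDensity τ f = 0 := by
    intro s hs hsρ hx
    refine ⟨s.indicator 1, measurable_one.indicator hs, fun x => ?_, ?_, ?_⟩
    · by_cases h : x ∈ s <;> simp [h]
    · rw [integral_indicator_one hs, hsρ]
    · rw [patternDensity, setIntegral_eq_zero_of_forall_eq_zero, mul_zero]
      intro x hxs
      by_cases hxi : x i ∈ s
      · refine Finset.prod_eq_zero (Finset.mem_univ j) ?_
        rw [hj]
        simp [letterFactor, hx x hxs hxi]
      · refine Finset.prod_eq_zero (Finset.mem_univ i) ?_
        rw [hi]
        simp [letterFactor, hxi]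
  have hij : i ≠ j := fun h => by rw [h, hj] at hi; cases hi
  rcases lt_or_gt_of_ne hij with hij | hij
  · refine key (Ici (1 - ρ)) measurableSet_Ici ?_ fun x hx hxi => le_trans hxi (hx.2 hij).le
    have : Ici (1 - ρ) ∩ Icc 0 1 = Icc (1 - ρ) 1 := by
      ext z; simp only [mem_inter_iff, mem_Ici, mem_Icc]
      exact ⟨fun hz => ⟨hz.1, hz.2.2⟩, fun hz => ⟨hz.1, by linarith [hρ.2, hz.1], hz.2⟩⟩
    rw [measureReal_def, lebesgueIcc, Measure.restrict_apply measurableSet_Ici, this,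
      Real.volume_Icc, sub_sub_cancel, ENNReal.toReal_ofReal hρ.1]
  · refine key (Iic ρ) measurableSet_Iic ?_ fun x hx hxi => le_trans (hx.2 hij).le hxi
    have : Iic ρ ∩ Icc 0 1 = Icc 0 ρ := by
      ext z; simp only [mem_inter_iff, mem_Iic, mem_Icc]
      exact ⟨fun hz => ⟨hz.2.1, hz.1⟩, fun hz => ⟨hz.2, hz.1, hz.2.trans hρ.2⟩⟩
    rw [measureReal_def, lebesgueIcc, Measure.restrict_apply measurableSet_Iic, this,
      Real.volume_Icc, sub_zero, ENNReal.toReal_ofReal hρ.1]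

/-! ### Upper bounds and attainment -/

theorem densityMeasure_compl_real_univ {f : ℝ → ℝ} (hf : Measurable f)
    (hf01 : ∀ x ∈ Icc (0 : ℝ) 1, f x ∈ Icc (0 : ℝ) 1) :
    (densityMeasure fun x => 1 - f x).real univ = 1 - ∫ x, f x ∂lebesgueIcc := by
  rw [densityMeasure_real_univ (f := fun x => 1 - f x) (by fun_prop) fun x hx =>
    letterFactor_mem_Icc (hf01 x hx) false, integral_sub (integrable_const _)
      (integrable_lebesgueIcc hf hf01)]
  simp

theorem patternDensity_nonneg {f : ℝ → ℝ} (hf : Measurable f)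
    (hf01 : ∀ x ∈ Icc (0 : ℝ) 1, f x ∈ Icc (0 : ℝ) 1) (τ : List Bool) :
    0 ≤ patternDensity τ f := by
  rw [patternDensity_eq hf hf01]
  exact mul_nonneg (Nat.cast_nonneg _) (orderedMass_nonneg _ _ _)

/-- This crude bound serves the endpoints `ρ = 0, 1`, where normalisation is impossible. -/
theorem patternDensity_le {f : ℝ → ℝ} (hf : Measurable f)
    (hf01 : ∀ x ∈ Icc (0 : ℝ) 1, f x ∈ Icc (0 : ℝ) 1) (τ : List Bool) :
    patternDensity τ f ≤ τ.length.factorial * ((∫ x, f x ∂lebesgueIcc) ^ τ.count true *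
      (1 - ∫ x, f x ∂lebesgueIcc) ^ τ.count false) := by
  have := isFiniteMeasure_densityMeasure hf hf01
  have := isFiniteMeasure_densityMeasure (f := fun x => 1 - f x) (by fun_prop) fun x hx =>
    letterFactor_mem_Icc (hf01 x hx) false
  rw [patternDensity_eq hf hf01]
  gcongr
  refine (orderedMass_le _ _ _).trans_eq ?_
  rw [densityMeasure_real_univ hf hf01, densityMeasure_compl_real_univ hf hf01]

theorem isProbabilityMeasure_inv_smul {μ : Measure ℝ} [IsFiniteMeasure μ] {a : NNReal}
    (ha : a ≠ 0) (h : μ.real univ = a) : IsProbabilityMeasure (a⁻¹ • μ) := ⟨by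
  have : μ univ = a := by
    rw [← ENNReal.ofReal_toReal (measure_ne_top μ univ), ← measureReal_def, h,
      ENNReal.ofReal_coe_nnreal]
  rw [Measure.smul_apply, this, ENNReal.smul_def, smul_eq_mul, ENNReal.coe_inv ha,
    ENNReal.inv_mul_cancel (by simpa using ha) ENNReal.coe_ne_top]⟩

/-- For densities of mean in `(0,1)`, the weighted maximum over `fairPairs` bounds the pattern
density. -/
theorem patternDensity_le_of_isMax {τ : List Bool} {M : ℝ}
    (hM : ∀ q ∈ fairPairs, orderedMass τ q.1 q.2 ≤ M) {f : ℝ → ℝ} (hf : Measurable f)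
    (hf01 : ∀ x ∈ Icc (0 : ℝ) 1, f x ∈ Icc (0 : ℝ) 1) {a b : NNReal} (ha : a ≠ 0) (hb : b ≠ 0)
    (hab : (a + b : ℝ) = 1) (hfa : ∫ x, f x ∂lebesgueIcc = a) :
    patternDensity τ f ≤ τ.length.factorial * (a ^ τ.count true * b ^ τ.count false * M) := by
  have := isFiniteMeasure_densityMeasure hf hf01
  have := isFiniteMeasure_densityMeasure (f := fun x => 1 - f x) (by fun_prop) fun x hx =>
    letterFactor_mem_Icc (hf01 x hx) false
  have hα := isProbabilityMeasure_inv_smul ha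
    ((densityMeasure_real_univ hf hf01).trans hfa)
  have hβ := isProbabilityMeasure_inv_smul (μ := densityMeasure fun x => 1 - f x) hb
    (by rw [densityMeasure_compl_real_univ hf hf01, hfa]; linarith)
  have h2 : (2⁻¹ : NNReal) ≠ 0 := by norm_num
  have hsum := densityMeasure_add_compl hf hf01
  rw [← smul_inv_smul₀ ha (densityMeasure f),
    ← smul_inv_smul₀ hb (densityMeasure fun x => 1 - f x)] at hsum
  -- Passing to the weights `1/2, 1/2` yields a pair in `fairPairs`, to which `hM` applies.
  obtain ⟨α', β', hα', hβ', hsum', heq⟩ := exists_reweight τ ha hb h2 h2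
    (by rw [← two_mul, mul_inv_cancel₀ two_ne_zero]) hsum
  rw [patternDensity_eq hf hf01, ← smul_inv_smul₀ ha (densityMeasure f),
    ← smul_inv_smul₀ hb (densityMeasure fun x => 1 - f x), orderedMass_smul, ← heq]
  gcongr
  refine hM (⟨α', hα'⟩, ⟨β', hβ'⟩) ?_
  change α' + β' = _
  rw [← hsum', ← smul_add, smul_inv_smul₀ two_ne_zero]

/-- The reverse passage, from `1/2, 1/2` to `a, b`; the density is recovered from the reweighted
measures. -/
theorem exists_patternDensity_eq (τ : List Bool)
    {p : ProbabilityMeasure ℝ × ProbabilityMeasure ℝ} (hp : p ∈ fairPairs) {a b : NNReal}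
    (ha : a ≠ 0) (hb : b ≠ 0) (hab : a + b = 1) :
    ∃ f : ℝ → ℝ, Measurable f ∧ (∀ x, f x ∈ Icc (0 : ℝ) 1) ∧ ∫ x, f x ∂lebesgueIcc = a ∧
      patternDensity τ f = τ.length.factorial *
        (a ^ τ.count true * b ^ τ.count false * orderedMass τ p.1 p.2) := by
  have h2 : (2⁻¹ : NNReal) ≠ 0 := by norm_num
  have hp' : (p.1 : Measure ℝ) + (p.2 : Measure ℝ) = (2 : NNReal) • lebesgueIcc := hp
  obtain ⟨α', β', hα', hβ', hsum', heq⟩ := exists_reweight τ h2 h2 ha hb hab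
    (α := p.1) (β := p.2) (by rw [← smul_add, hp', inv_smul_smul₀ two_ne_zero])
  obtain ⟨f, hf, hf01, hα, hβ⟩ := exists_density hsum'
  refine ⟨f, hf, hf01, ?_, ?_⟩
  · rw [← densityMeasure_real_univ hf fun x _ => hf01 x, hα, measureReal_nnreal_smul_apply]
    simp
  · rw [patternDensity_eq hf fun x _ => hf01 x, hα, hβ, orderedMass_smul, heq]

theorem mem_feasibleSet_iff {τ : List Bool} {ρ δ : ℝ} (hρ : ρ ∈ Icc (0 : ℝ) 1) :
    ![ρ, δ] ∈ feasibleSet ![[true], τ] ↔ ∃ f : ℝ → ℝ, Measurable f ∧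
      (∀ x ∈ Icc (0 : ℝ) 1, f x ∈ Icc (0 : ℝ) 1) ∧ ∫ x, f x ∂lebesgueIcc = ρ ∧
        patternDensity τ f = δ := by
  constructor
  · rintro ⟨-, μ, f, hμ, hW⟩
    refine ⟨f, hμ.measurable, hμ.mem_Icc, ?_, hW 1⟩
    rw [← patternDensity_true]
    exact hW 0
  · rintro ⟨f, hf, hf01, rfl, rfl⟩
    refine ⟨Fin.forall_fin_two.2 ⟨hρ, patternDensity_nonneg hf hf01 τ,
      patternDensity_le_one hf01 τ⟩, _, f, ⟨hf, hf01, rfl⟩, Fin.forall_fin_two.2 ⟨?_, rfl⟩⟩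
    exact patternDensity_true f

end PatternDensity

/-! ### The theorem -/

open PatternDensity in
theorem mainTheorem2 (τ : List Bool) (h1 : true ∈ τ) (h0 : false ∈ τ) :
    ∃ C : ℝ, ∀ ρ ∈ Set.Icc (0 : ℝ) 1,
      {δ : ℝ | ![ρ, δ] ∈ PatternDensity.feasibleSet ![[true], τ]} =
        Set.Icc 0 (C * ρ ^ τ.count true * (1 - ρ) ^ τ.count false) := by
  obtain ⟨p, hp, hmax⟩ := exists_isMaxOn_orderedMass τ
  refine ⟨τ.length.factorial * orderedMass τ p.1 p.2, fun ρ hρ => ?_⟩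
  ext δ
  rw [mem_ofPred_eq, mem_feasibleSet_iff hρ]
  obtain ⟨g, hg, hg01, hgρ, hgτ⟩ := exists_patternDensity_eq_zero h1 h0 hρ
  by_cases hz : ρ = 0 ∨ ρ = 1
  · have hzero : ρ ^ τ.count true * (1 - ρ) ^ τ.count false = 0 := by
      rcases hz with rfl | rfl
      · rw [zero_pow (List.count_pos_iff.2 h1).ne', zero_mul]
      · rw [sub_self, zero_pow (List.count_pos_iff.2 h0).ne', mul_zero]
    rw [mul_assoc, hzero, mul_zero, Icc_self, mem_singleton_iff]
    constructor
    · rintro ⟨f, hf, hf01, hfρ, rfl⟩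
      refine le_antisymm ?_ (patternDensity_nonneg hf hf01 τ)
      have := patternDensity_le hf hf01 τ
      rwa [hfρ, hzero, mul_zero] at this
    · rintro rfl
      exact ⟨g, hg, fun x _ => hg01 x, hgρ, hgτ⟩
  · rw [not_or] at hz
    let a : NNReal := ⟨ρ, hρ.1⟩
    let b : NNReal := ⟨1 - ρ, sub_nonneg.2 hρ.2⟩
    have ha : a ≠ 0 := fun h => hz.1 (congrArg NNReal.toReal h)
    have hb : b ≠ 0 := fun h => hz.2 (sub_eq_zero.1 (congrArg NNReal.toReal h)).symm
    have hab : (a + b : ℝ) = 1 := add_sub_cancel ρ 1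
    have hC : τ.length.factorial * orderedMass τ p.1 p.2 * ρ ^ τ.count true *
        (1 - ρ) ^ τ.count false = τ.length.factorial *
          ((a : ℝ) ^ τ.count true * (b : ℝ) ^ τ.count false * orderedMass τ p.1 p.2) := by
      change _ = τ.length.factorial *
        (ρ ^ τ.count true * (1 - ρ) ^ τ.count false * orderedMass τ p.1 p.2)
      ring
    rw [hC]
    constructor
    · rintro ⟨f, hf, hf01, hfρ, rfl⟩
      exact ⟨patternDensity_nonneg hf hf01 τ,
        patternDensity_le_of_isMax hmax hf hf01 ha hb hab hfρ⟩
    · intro hδ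
      obtain ⟨f, hf, hf01, hfρ, hfτ⟩ :=
        exists_patternDensity_eq τ hp ha hb (NNReal.coe_injective hab)
      -- The segment from the zero-density `g` to the maximiser `f` keeps the mean `ρ`, so the
      -- intermediate value theorem reaches every `δ`.
      have hmem : ∀ t ∈ Icc (0 : ℝ) 1, ∀ x, (1 - t) * g x + t * f x ∈ Icc (0 : ℝ) 1 :=
        fun t ht x => convex_Icc (0 : ℝ) 1 (hg01 x) (hf01 x) (sub_nonneg.2 ht.2) ht.1
          (sub_add_cancel 1 t)
      obtain ⟨t, ht, rfl⟩ := intermediate_value_Icc zero_le_one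
        (continuousOn_patternDensity_segment hg hf hmem τ)
        (show δ ∈ Icc _ _ by simpa [hgτ, hfτ] using hδ)
      refine ⟨_, by fun_prop, fun x _ => hmem t ht x, ?_, rfl⟩
      rw [integral_add ((integrable_lebesgueIcc hg fun x _ => hg01 x).const_mul _)
        ((integrable_lebesgueIcc hf fun x _ => hf01 x).const_mul _), integral_const_mul,
        integral_const_mul, hgρ, hfρ]
      change (1 - t) * ρ + t * ρ = ρ
      ring
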